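/- **Setting.** Let $n\ge 2$, let $D\subseteq\mathbb{R}^n$ be open and bounded (not necessarily connected), and let $\Gamma\subseteq\partial D$ be non-empty and relatively open in $\partial D$. Assume: * $D$ is *locally uniform*: there are $\varepsilon\in(0,1]$, $\delta,c_0\in(0,\infty]$ such that any $x,y\in D$ with $|x-y|<\delta$ can be joined by a rectifiable curve in $D$ of length at most $\varepsilon^{-1}|x-y|$ all of whose points $z$ satisfy $\operatorname{dist}(z,\partial D)\ge \varepsilon|z-x||z-y|/|x-y|$, and every connected component of $D$ has diameter at least $c_0$; * $\Gamma$ is a *$d$-set* for some real $d\in(n-2,n)$: there is $c_1\in(0,1]$ with $c_1r^d\le\mathcal{H}^d(\Gamma\cap B(x,r))\le c_1^{-1}r^d$ for all $x\in\Gamma$, $r\in(0,1]$. Write $\sigma$ for the $d$-dimensional Hausdorff measure on $\Gamma$, and $\mathrm W^{1,2}(D)$ for the space of all $u\in\mathrm L^2(D)$ with distributional gradient $\nabla u\in\mathrm L^2(D)^n$, normed by $\|u\|_{\mathrm W^{1,2}(D)}^2=\|u\|_{\mathrm L^2(D)}^2+\|\nabla u\|_{\mathrm L^2(D)}^2$.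 Let $\tilde q\in(\tfrac{d}{d+2-n},\infty]$ and define $q$ by $\tfrac1{\tilde q}+\tfrac2q=1$. Let $\gamma\colon\mathrm W^{1,2}(D)\to\mathrm L^q(\Gamma,\sigma)$ be the trace operator, that is, the bounded extension by density of the restriction $u\mapsto u|_\Gamma$, $u\in\mathrm W^{1,2}(D)\cap\mathrm C(\overline D)$. Let $A\in\mathrm L^\infty(D;\mathbb{C}^{n\times n})$ and $b\in\mathrm L^{\tilde q}(\Gamma;\mathbb{C})$, put $$a(u,v)=\int_D A\nabla u\cdot\overline{\nabla v}\,dx+\int_\Gamma b\,\gamma(u)\,\overline{\gamma(v)}\,d\sigma\qquad(u,v\in \mathrm W^{1,2}(D)),$$ and assume, for some $\lambda>0$, that $\operatorname{Re}a(u,u)\ge\lambda\|u\|_{\mathrm W^{1,2}(D)}^2$ for all $u\in\mathrm W^{1,2}(D)$. Let $L$ be the operator in $\mathrm L^2(D)$ associated with $a$: $u\in\operatorname{dom}(L)$ and $Lu=g$ if and only if $u\in\mathrm W^{1,2}(D)$, $g\in\mathrm L^2(D)$ and $a(u,v)=\int_D g\,\overline v\,dx$ for all $v\in\mathrm W^{1,2}(D)$.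 **Proposition (off-diagonal estimates).** For every $t>0$ and every $f\in\mathrm L^2(D)$ there is exactly one $u\in\operatorname{dom}(L)$ with $u+t^2Lu=f$, written $u=(1+t^2L)^{-1}f$. Moreover, there are constants $C,c>0$ depending only on $n$, $\lambda$ and (an upper bound for) $\|A\|_\infty$ such that for all measurable sets $E,F\subseteq D$, all $t>0$ and all $f\in\mathrm L^2(D)$ that vanish almost everywhere outside $E$, the function $u=(1+t^2L)^{-1}f$ satisfies $$\|u\|_{\mathrm L^2(F)}+\|tu\|_{\mathrm L^2(F)}+\|t\nabla u\|_{\mathrm L^2(F)}\le C\,e^{-c\,\operatorname{dist}(E,F)/t}\,\|f\|_{\mathrm L^2(E)}$$ and $$\|u\|_{\mathrm L^2(F)}+\|t\gamma(u)\|_{\mathrm L^q(\overline F\cap\Gamma,\sigma)}+\|tu\|_{\mathrm L^2(F)}+\|t\nabla u\|_{\mathrm L^2(F)}\le C\,(1+\|\gamma\|)\,e^{-c\,\operatorname{dist}(E,F)/t}\,\|f\|_{\mathrm L^2(E)},$$ where $\|\gamma\|$ is the operator norm of $\gamma\colon\mathrm W^{1,2}(D)\to\mathrm L^q(\Gamma,\sigma)$,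 which depends only on $D$, $\Gamma$, $d$ and $q$, and not on $A$, $b$ or $\lambda$. -/

import Mathlib

open MeasureTheory
open scoped ENNReal NNReal ContDiff ComplexConjugate

namespace Robin

noncomputable section

/-! ### Geometry -/

/-- `x` and `y` can be joined in `D` by an `ε`-cigar: a rectifiable curve in `D` of length at most
`ε⁻¹ |x - y|` all of whose points `z` satisfy `dist(z, ∂D) ≥ ε |z - x| |z - y| / |x - y|`. -/
def JoinedByCigar {n : ℕ} (D : Set (EuclideanSpace ℝ (Fin n))) (ε : ℝ)
    (x y : EuclideanSpace ℝ (Fin n)) : Prop :=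
  ∃ p : ℝ → EuclideanSpace ℝ (Fin n),
    ContinuousOn p (Set.Icc 0 1) ∧ p 0 = x ∧ p 1 = y ∧ (∀ s ∈ Set.Icc (0 : ℝ) 1, p s ∈ D) ∧
    eVariationOn p (Set.Icc 0 1) ≤ ENNReal.ofReal (ε⁻¹ * dist x y) ∧
    ∀ s ∈ Set.Icc (0 : ℝ) 1,
      ENNReal.ofReal (ε * (dist (p s) x * dist (p s) y) / dist x y) ≤
        Metric.infEDist (p s) (frontier D)

/-- Locally uniform sets: points at distance less than `δ` are joined by `ε`-cigars, and every
connected component has diameter at least `c`. -/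
def IsLocallyUniform {n : ℕ} (D : Set (EuclideanSpace ℝ (Fin n))) : Prop :=
  ∃ (ε : ℝ) (δ c : ℝ≥0∞), 0 < ε ∧ ε ≤ 1 ∧ 0 < δ ∧ 0 < c ∧
    (∀ x ∈ D, ∀ y ∈ D, edist x y < δ → JoinedByCigar D ε x y) ∧
    ∀ x ∈ D, c ≤ Metric.ediam (connectedComponentIn D x)

/-- `d`-sets: `c r ^ d ≤ ℋ^d (Γ ∩ B(x, r)) ≤ c⁻¹ r ^ d` for `x ∈ Γ` and `0 < r ≤ 1`. -/
def IsDSet {n : ℕ} (d : ℝ) (Γ : Set (EuclideanSpace ℝ (Fin n))) : Prop :=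
  ∃ c : ℝ, 0 < c ∧ c ≤ 1 ∧ ∀ x ∈ Γ, ∀ r : ℝ, 0 < r → r ≤ 1 →
    ENNReal.ofReal (c * r ^ d) ≤ (Measure.hausdorffMeasure d) (Γ ∩ Metric.ball x r) ∧
    (Measure.hausdorffMeasure d) (Γ ∩ Metric.ball x r) ≤ ENNReal.ofReal (c⁻¹ * r ^ d)

/-- The distance `inf {|x - y| : x ∈ E, y ∈ F}` of two non-empty sets (and `0` if one of them is
empty). -/
def setDist {n : ℕ} (E F : Set (EuclideanSpace ℝ (Fin n))) : ℝ :=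
  (⨅ x ∈ E, Metric.infEDist x F).toReal

/-- The surface measure on `Γ`: the `d`-dimensional Hausdorff measure, restricted to `Γ`. -/
def surf {n : ℕ} (d : ℝ) (Γ : Set (EuclideanSpace ℝ (Fin n))) :
    Measure (EuclideanSpace ℝ (Fin n)) :=
  (Measure.hausdorffMeasure d).restrict Γ

/-! ### The Sobolev space `W^{1,2}(D)` -/

/-- The complex Hilbert space `L²(D)`. -/
abbrev L2 {n : ℕ} (D : Set (EuclideanSpace ℝ (Fin n))) : Type :=
  Lp ℂ 2 (volume.restrict D)

/-- The complex Hilbert space `L²(D)ⁿ`. -/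
abbrev L2Vec {n : ℕ} (D : Set (EuclideanSpace ℝ (Fin n))) : Type :=
  Lp (EuclideanSpace ℂ (Fin n)) 2 (volume.restrict D)

/-- `g` is the distributional gradient of `u` on `D`. -/
def IsWeakGradient {n : ℕ} (D : Set (EuclideanSpace ℝ (Fin n)))
    (u : EuclideanSpace ℝ (Fin n) → ℂ)
    (g : EuclideanSpace ℝ (Fin n) → EuclideanSpace ℂ (Fin n)) : Prop :=
  ∀ φ : EuclideanSpace ℝ (Fin n) → ℝ, ContDiff ℝ ∞ φ → HasCompactSupport φ → tsupport φ ⊆ D →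
    ∀ i : Fin n,
      ∫ x in D, fderiv ℝ φ x (EuclideanSpace.single i 1) • u x = - ∫ x in D, φ x • g x i

theorem integrable_test_smul {n : ℕ} {D : Set (EuclideanSpace ℝ (Fin n))}
    {ψ : EuclideanSpace ℝ (Fin n) → ℝ} {u : EuclideanSpace ℝ (Fin n) → ℂ}
    (hψ : Continuous ψ) (hc : HasCompactSupport ψ) (hu : MemLp u 2 (volume.restrict D)) :
    Integrable (fun x => ψ x • u x) (volume.restrict D) :=
  memLp_one_iff_integrable.1 (hu.smul (hψ.memLp_of_hasCompactSupport (p := 2) hc))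

theorem integrable_deriv_smul {n : ℕ} {D : Set (EuclideanSpace ℝ (Fin n))}
    {φ : EuclideanSpace ℝ (Fin n) → ℝ} {u : EuclideanSpace ℝ (Fin n) → ℂ}
    (hφ : ContDiff ℝ ∞ φ) (hc : HasCompactSupport φ) (hu : MemLp u 2 (volume.restrict D))
    (v : EuclideanSpace ℝ (Fin n)) :
    Integrable (fun x => fderiv ℝ φ x v • u x) (volume.restrict D) :=
  integrable_test_smul ((hφ.continuous_fderiv (by simp)).clm_apply continuous_const)
    (hc.fderiv_apply ℝ v) hu

theorem memLp_coord {n : ℕ} {D : Set (EuclideanSpace ℝ (Fin n))} (g : L2Vec D) (i : Fin n) :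
    MemLp (fun x => g x i) 2 (volume.restrict D) :=
  (EuclideanSpace.proj (𝕜 := ℂ) i).comp_memLp' (Lp.memLp g)

/-- The Sobolev space `W^{1,2}(D)`, as the space of pairs `(u, ∇u)` of an `L²`-function and its
distributional gradient in `L²`. The norm is `‖u‖² = ‖u‖²_{L²} + ‖∇u‖²_{L²}`. -/
def W12 {n : ℕ} (D : Set (EuclideanSpace ℝ (Fin n))) :
    Submodule ℂ (WithLp 2 (L2 D × L2Vec D)) where
  carrier := {w | IsWeakGradient D w.fst w.snd}
  zero_mem' := by
    intro φ hφ hc hs i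
    have h1 : ∫ x in D, fderiv ℝ φ x (EuclideanSpace.single i 1) • ((0 : L2 D) x) = 0 := by
      refine integral_eq_zero_of_ae ?_
      filter_upwards [Lp.coeFn_zero ℂ 2 (volume.restrict D)] with x hx
      simp only [hx, Pi.zero_apply, smul_zero]
    have h2 : ∫ x in D, φ x • ((0 : L2Vec D) x i) = 0 := by
      refine integral_eq_zero_of_ae ?_
      filter_upwards [Lp.coeFn_zero (EuclideanSpace ℂ (Fin n)) 2 (volume.restrict D)] with x hx
      simp only [hx, Pi.zero_apply, PiLp.zero_apply, smul_zero]
    rw [WithLp.zero_fst, WithLp.zero_snd, h1, h2, neg_zero]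
  add_mem' := by
    intro v w hv hw φ hφ hc hs i
    have h1 : ∫ x in D, fderiv ℝ φ x (EuclideanSpace.single i 1) • ((v.fst + w.fst : L2 D) x) =
        (∫ x in D, fderiv ℝ φ x (EuclideanSpace.single i 1) • v.fst x) +
          ∫ x in D, fderiv ℝ φ x (EuclideanSpace.single i 1) • w.fst x := by
      rw [← integral_add (integrable_deriv_smul hφ hc (Lp.memLp _) _)
        (integrable_deriv_smul hφ hc (Lp.memLp _) _)]
      refine integral_congr_ae ?_
      filter_upwards [Lp.coeFn_add v.fst w.fst] with x hx
      simp only [hx, Pi.add_apply, smul_add]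
    have h2 : ∫ x in D, φ x • ((v.snd + w.snd : L2Vec D) x i) =
        (∫ x in D, φ x • v.snd x i) + ∫ x in D, φ x • w.snd x i := by
      rw [← integral_add (integrable_test_smul hφ.continuous hc (memLp_coord _ i))
        (integrable_test_smul hφ.continuous hc (memLp_coord _ i))]
      refine integral_congr_ae ?_
      filter_upwards [Lp.coeFn_add v.snd w.snd] with x hx
      simp only [hx, Pi.add_apply, PiLp.add_apply, smul_add]
    have e1 := hv φ hφ hc hs i
    have e2 := hw φ hφ hc hs i
    rw [WithLp.add_fst, WithLp.add_snd, h1, h2, e1, e2]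
    ring
  smul_mem' := by
    intro a w hw φ hφ hc hs i
    have h1 : ∫ x in D, fderiv ℝ φ x (EuclideanSpace.single i 1) • ((a • w.fst : L2 D) x) =
        a * ∫ x in D, fderiv ℝ φ x (EuclideanSpace.single i 1) • w.fst x := by
      rw [← integral_const_mul]
      refine integral_congr_ae ?_
      filter_upwards [Lp.coeFn_smul a w.fst] with x hx
      simp only [hx, Pi.smul_apply, smul_eq_mul, mul_smul_comm]
    have h2 : ∫ x in D, φ x • ((a • w.snd : L2Vec D) x i) =
        a * ∫ x in D, φ x • w.snd x i := by
      rw [← integral_const_mul]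
      refine integral_congr_ae ?_
      filter_upwards [Lp.coeFn_smul a w.snd] with x hx
      simp only [hx, Pi.smul_apply, PiLp.smul_apply, smul_eq_mul, mul_smul_comm]
    have e1 := hw φ hφ hc hs i
    rw [WithLp.smul_fst, WithLp.smul_snd, h1, h2, e1]
    ring

/-- The function `u ∈ L²(D)` underlying an element of `W^{1,2}(D)`. -/
def sobFn {n : ℕ} {D : Set (EuclideanSpace ℝ (Fin n))} (u : W12 D) : L2 D := u.1.fst

/-- The gradient `∇u ∈ L²(D)ⁿ` of an element of `W^{1,2}(D)`. -/
def sobGrad {n : ℕ} {D : Set (EuclideanSpace ℝ (Fin n))} (u : W12 D) : L2Vec D := u.1.snd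

/-! ### The trace operator -/

/-- `W^{1,2}(D) ∩ C(closure D)`, as the space of pairs `(u, φ)` where `u ∈ W^{1,2}(D)` coincides
almost everywhere on `D` with a function `φ` that is continuous on the closure of `D`. The last
condition, `φ|_Γ ∈ L^q(Γ)`, is automatic if `D` is bounded and `Γ ⊆ ∂D` is a Borel set
of finite measure. -/
def contW12 {n : ℕ} (D Γ : Set (EuclideanSpace ℝ (Fin n))) (d : ℝ) (q : ℝ≥0∞) :
    Submodule ℂ (W12 D × (EuclideanSpace ℝ (Fin n) → ℂ)) where
  carrier := {w | ContinuousOn w.2 (closure D) ∧ (sobFn w.1) =ᵐ[volume.restrict D] w.2 ∧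
    MemLp w.2 q (surf d Γ)}
  zero_mem' := ⟨continuousOn_const, Lp.coeFn_zero ℂ 2 (volume.restrict D), MemLp.zero⟩
  add_mem' := by
    rintro v w ⟨hv1, hv2, hv3⟩ ⟨hw1, hw2, hw3⟩
    exact ⟨hv1.add hw1, (Lp.coeFn_add (sobFn v.1) (sobFn w.1)).trans (hv2.add hw2), hv3.add hw3⟩
  smul_mem' := by
    rintro a w ⟨hw1, hw2, hw3⟩
    exact ⟨continuousOn_const.smul hw1, (Lp.coeFn_smul a (sobFn w.1)).trans (hw2.const_smul a),
      hw3.const_smul a⟩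

/-- The restriction `φ ↦ φ|_Γ` from `W^{1,2}(D) ∩ C(closure D)` to `L^q(Γ)`. -/
def restrictToBoundary {n : ℕ} (D Γ : Set (EuclideanSpace ℝ (Fin n))) (d : ℝ) (q : ℝ≥0∞) :
    contW12 D Γ d q →ₗ[ℂ] Lp ℂ q (surf d Γ) where
  toFun w := MemLp.toLp w.1.2 w.2.2.2
  map_add' v w := MemLp.toLp_add v.2.2.2 w.2.2.2
  map_smul' a w := MemLp.toLp_const_smul a w.2.2.2

/-- The inclusion of `W^{1,2}(D) ∩ C(closure D)` into `W^{1,2}(D)`. -/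
def contInclusion {n : ℕ} (D Γ : Set (EuclideanSpace ℝ (Fin n))) (d : ℝ) (q : ℝ≥0∞) :
    contW12 D Γ d q →ₗ[ℂ] W12 D :=
  (LinearMap.fst ℂ (W12 D) (EuclideanSpace ℝ (Fin n) → ℂ)).comp (contW12 D Γ d q).subtype

/-- The trace operator `γ : W^{1,2}(D) → L^q(Γ)`: the extension by density of the restriction
`φ ↦ φ|_Γ`, defined on `W^{1,2}(D) ∩ C(closure D)`, to a bounded linear operator. -/
def trace {n : ℕ} (D Γ : Set (EuclideanSpace ℝ (Fin n))) (d : ℝ) (q : ℝ≥0∞) [Fact (1 ≤ q)] :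
    W12 D →L[ℂ] Lp ℂ q (surf d Γ) :=
  (restrictToBoundary D Γ d q).extendOfNorm (contInclusion D Γ d q)

/-! ### The Robin form and the Robin operator -/

/-- The coefficient matrix at a point, acting on `ℂⁿ` with its Euclidean norm. -/
def coeff {n : ℕ} (A : EuclideanSpace ℝ (Fin n) → Matrix (Fin n) (Fin n) ℂ)
    (x : EuclideanSpace ℝ (Fin n)) : EuclideanSpace ℂ (Fin n) →L[ℂ] EuclideanSpace ℂ (Fin n) :=
  Matrix.toEuclideanCLM (𝕜 := ℂ) (A x)

/-- The Robin form
`a(u, v) = ∫_D A ∇u · conj (∇v) dx + ∫_Γ b γ(u) conj (γ(v)) dσ` on `W^{1,2}(D)`. -/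
def robinForm {n : ℕ} (D Γ : Set (EuclideanSpace ℝ (Fin n))) (d : ℝ) (q : ℝ≥0∞) [Fact (1 ≤ q)]
    (A : EuclideanSpace ℝ (Fin n) → Matrix (Fin n) (Fin n) ℂ) (b : EuclideanSpace ℝ (Fin n) → ℂ)
    (u v : W12 D) : ℂ :=
  (∫ x in D, inner ℂ (sobGrad v x) (coeff A x (sobGrad u x))) +
    ∫ x, b x * trace D Γ d q u x * conj (trace D Γ d q v x) ∂(surf d Γ)

/-- `u ∈ dom(L)` and `L u = g`, where `L` is the operator in `L²(D)` associated with the Robin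
form: `u ∈ W^{1,2}(D)`, `g ∈ L²(D)` and `a(u, v) = ∫_D g conj v dx` for all `v ∈ W^{1,2}(D)`. -/
def IsRobinImage {n : ℕ} (D Γ : Set (EuclideanSpace ℝ (Fin n))) (d : ℝ) (q : ℝ≥0∞)
    [Fact (1 ≤ q)] (A : EuclideanSpace ℝ (Fin n) → Matrix (Fin n) (Fin n) ℂ)
    (b : EuclideanSpace ℝ (Fin n) → ℂ) (u : W12 D) (g : L2 D) : Prop :=
  ∀ v : W12 D, robinForm D Γ d q A b u v = ∫ x in D, g x * conj (sobFn v x)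

/-- `u = (1 + t² L)⁻¹ f`, that is, `u ∈ dom(L)` and `u + t² L u = f`. -/
def IsRobinResolvent {n : ℕ} (D Γ : Set (EuclideanSpace ℝ (Fin n))) (d : ℝ) (q : ℝ≥0∞)
    [Fact (1 ≤ q)] (A : EuclideanSpace ℝ (Fin n) → Matrix (Fin n) (Fin n) ℂ)
    (b : EuclideanSpace ℝ (Fin n) → ℂ) (t : ℝ) (f : L2 D) (u : W12 D) : Prop :=
  ∃ g : L2 D, IsRobinImage D Γ d q A b u g ∧ sobFn u + ((t ^ 2 : ℝ) : ℂ) • g = f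

end

end Robin

open Robin

/-! Existence and uniqueness follow from the Lax-Milgram theorem for the form (u, v) + t² a(u, v) on
W^{1,2}(D), which is complete (`isClosed_W12`).

The decay comes from Davies' exponential perturbation. Take a smooth 1-Lipschitz ψ within t of
dist(·, E), put s = c / t, and test the equation with exp(2sψ) u. With w = exp(sψ) u and P = w
∇(sψ), one has exp(sψ) ∇u = ∇w - P, so the equation becomes an energy identity for w, up to terms
containing P, where ‖P‖ ≤ s ‖w‖ in L². The boundary integral creates no such term: the real weight
moves from one factor to the other, and the trace commutes with smooth multipliers (`trace_mul`).
Hence b does not enter the constants.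

As s t = c, mass and coercivity absorb the errors once c is small in terms of λ and Λ
(`absorb_error`). On E the weight is at most exp(c), and on the closure of F it is at least exp(-c)
exp(c dist(E, F) / t); dividing it out gives the decay (`off_diagonal_estimate`). The trace estimate
is boundedness of γ applied to w. -/

namespace Robin

noncomputable section

/-! ### Bounded multipliers -/

section Bounded

variable {n : ℕ}

theorem memLp_top_restrict_of_continuous {G : Type*} [NormedAddCommGroup G]
    [SecondCountableTopologyEither (EuclideanSpace ℝ (Fin n)) G]
    {S : Set (EuclideanSpace ℝ (Fin n))} (hS : MeasurableSet S) (hb : Bornology.IsBounded S)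
    (μ : Measure (EuclideanSpace ℝ (Fin n))) {h : EuclideanSpace ℝ (Fin n) → G}
    (hh : Continuous h) : MemLp h ∞ (μ.restrict S) := by
  obtain ⟨C, hC⟩ := hb.isCompact_closure.exists_bound_of_continuousOn hh.continuousOn
  exact memLp_top_of_bound hh.aestronglyMeasurable C
    ((ae_restrict_iff' hS).2 (.of_forall fun x hx => hC x (subset_closure hx)))

/-- The gradient of a real function, as a complex vector field. -/
def gradC (η : EuclideanSpace ℝ (Fin n) → ℝ) (x : EuclideanSpace ℝ (Fin n)) :
    EuclideanSpace ℂ (Fin n) :=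
  WithLp.toLp 2 fun i => ((fderiv ℝ η x (EuclideanSpace.single i 1) : ℝ) : ℂ)

theorem gradC_apply (η : EuclideanSpace ℝ (Fin n) → ℝ) (x : EuclideanSpace ℝ (Fin n))
    (i : Fin n) : gradC η x i = ((fderiv ℝ η x (EuclideanSpace.single i 1) : ℝ) : ℂ) := rfl

/-- The coordinates of `gradC η x` are those of the Riesz representative of the derivative, whose
Euclidean norm is the dual norm. -/
theorem norm_gradC_le (η : EuclideanSpace ℝ (Fin n) → ℝ) (x : EuclideanSpace ℝ (Fin n)) :
    ‖gradC η x‖ ≤ ‖fderiv ℝ η x‖ := by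
  set v : EuclideanSpace ℝ (Fin n) :=
    (InnerProductSpace.toDual ℝ (EuclideanSpace ℝ (Fin n))).symm (fderiv ℝ η x)
  have hv : ‖v‖ = ‖fderiv ℝ η x‖ := LinearIsometryEquiv.norm_map _ _
  rw [← hv, EuclideanSpace.norm_eq, EuclideanSpace.norm_eq]
  refine le_of_eq (congrArg _ (Finset.sum_congr rfl fun i _ => ?_))
  have h : v i = fderiv ℝ η x (EuclideanSpace.single i 1) := by
    rw [← InnerProductSpace.toDual_symm_apply (𝕜 := ℝ) (y := fderiv ℝ η x),
      EuclideanSpace.inner_single_right]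
    simp [v]
  rw [gradC_apply, h, Complex.norm_real]

theorem continuous_gradC {η : EuclideanSpace ℝ (Fin n) → ℝ} (hη : ContDiff ℝ ∞ η) :
    Continuous (gradC η) := by
  refine (PiLp.continuous_toLp 2 _).comp (continuous_pi fun i => ?_)
  exact Complex.continuous_ofReal.comp
    ((hη.continuous_fderiv (by simp)).clm_apply continuous_const)

/-- Multiplication of `L^p` functions by an essentially bounded function. -/
theorem exists_mulLp {μ : Measure (EuclideanSpace ℝ (Fin n))} {G : Type*} [NormedAddCommGroup G]
    [NormedSpace ℂ G] {p : ℝ≥0∞} [Fact (1 ≤ p)] {h : EuclideanSpace ℝ (Fin n) → ℂ}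
    (hh : MemLp h ∞ μ) :
    ∃ M : Lp G p μ →L[ℂ] Lp G p μ, ∀ u, M u =ᵐ[μ] fun x => h x • u x := by
  refine ⟨(ContinuousLinearMap.lsmul ℂ ℂ).holderL μ ∞ p p hh.toLp, fun u => ?_⟩
  filter_upwards [(ContinuousLinearMap.lsmul ℂ ℂ).coeFn_holder (r := p) hh.toLp u,
    hh.coeFn_toLp] with x h1 h2
  rw [ContinuousLinearMap.holderL_apply_apply, h1, h2]
  rfl

/-- Multiplication of scalar `L^p` functions by an essentially bounded vector field. -/
theorem exists_mulVecLp {μ : Measure (EuclideanSpace ℝ (Fin n))} {G : Type*}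
    [NormedAddCommGroup G] [NormedSpace ℂ G] {p : ℝ≥0∞} [Fact (1 ≤ p)]
    {h : EuclideanSpace ℝ (Fin n) → G} (hh : MemLp h ∞ μ) :
    ∃ M : Lp ℂ p μ →L[ℂ] Lp G p μ, ∀ u, M u =ᵐ[μ] fun x => u x • h x := by
  refine ⟨(ContinuousLinearMap.lsmul ℂ ℂ).flip.holderL μ ∞ p p hh.toLp, fun u => ?_⟩
  filter_upwards [(ContinuousLinearMap.lsmul ℂ ℂ).flip.coeFn_holder (r := p) hh.toLp u,
    hh.coeFn_toLp] with x h1 h2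
  rw [ContinuousLinearMap.holderL_apply_apply, h1, h2]
  rfl

end Bounded

/-! ### Smooth multipliers on W^{1,2}(D) -/

section Sobolev

variable {n : ℕ} {D : Set (EuclideanSpace ℝ (Fin n))}

theorem norm_sq_eq (u : W12 D) : ‖u‖ ^ 2 = ‖sobFn u‖ ^ 2 + ‖sobGrad u‖ ^ 2 :=
  WithLp.prod_norm_sq_eq_of_L2 u.1

theorem norm_sobFn_le (u : W12 D) : ‖sobFn u‖ ≤ ‖u‖ :=
  le_of_sq_le_sq (by rw [norm_sq_eq]; linarith [sq_nonneg ‖sobGrad u‖]) (norm_nonneg _)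

theorem norm_sobGrad_le (u : W12 D) : ‖sobGrad u‖ ≤ ‖u‖ :=
  le_of_sq_le_sq (by rw [norm_sq_eq]; linarith [sq_nonneg ‖sobFn u‖]) (norm_nonneg _)

/-- The product rule for the weak gradient, with a smooth factor. -/
theorem isWeakGradient_mul {u : EuclideanSpace ℝ (Fin n) → ℂ}
    {g : EuclideanSpace ℝ (Fin n) → EuclideanSpace ℂ (Fin n)}
    (hu : MemLp u 2 (volume.restrict D)) (hg : ∀ i, MemLp (fun x => g x i) 2 (volume.restrict D))
    (h : IsWeakGradient D u g) {η : EuclideanSpace ℝ (Fin n) → ℝ} (hη : ContDiff ℝ ∞ η) :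
    IsWeakGradient D (fun x => (η x : ℂ) • u x)
      (fun x => (η x : ℂ) • g x + u x • gradC η x) := by
  intro φ hφ hc hs i
  have hφη : ContDiff ℝ ∞ (fun x => φ x * η x) := hφ.mul hη
  -- The product φη is again an admissible test function; differentiating it gives both terms of the
  -- product rule.
  have e := h _ hφη hc.mul_right ((tsupport_mul_subset_left).trans hs) i
  have hd (x : EuclideanSpace ℝ (Fin n)) :
      fderiv ℝ (fun x => φ x * η x) x (EuclideanSpace.single i 1) =
        φ x * fderiv ℝ η x (EuclideanSpace.single i 1) +
          η x * fderiv ℝ φ x (EuclideanSpace.single i 1) := by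
    rw [fderiv_fun_mul (hφ.differentiable (by simp) x) (hη.differentiable (by simp) x)]
    simp
  have cη : Continuous fun x => fderiv ℝ η x (EuclideanSpace.single i 1) :=
    (hη.continuous_fderiv (by simp)).clm_apply continuous_const
  have cφ : Continuous fun x => fderiv ℝ φ x (EuclideanSpace.single i 1) :=
    (hφ.continuous_fderiv (by simp)).clm_apply continuous_const
  have i1 : Integrable (fun x => (φ x * fderiv ℝ η x (EuclideanSpace.single i 1)) • u x)
      (volume.restrict D) := integrable_test_smul (hφ.continuous.mul cη) hc.mul_right hu
  have i2 : Integrable (fun x => (η x * fderiv ℝ φ x (EuclideanSpace.single i 1)) • u x)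
      (volume.restrict D) :=
    integrable_test_smul (hη.continuous.mul cφ) (hc.fderiv_apply ℝ _).mul_left hu
  have i3 : Integrable (fun x => (φ x * η x) • g x i) (volume.restrict D) :=
    integrable_test_smul hφη.continuous hc.mul_right (hg i)
  simp only [hd, add_smul] at e
  rw [integral_add i1 i2] at e
  have l : ∫ x in D, fderiv ℝ φ x (EuclideanSpace.single i 1) • ((η x : ℂ) • u x) =
      ∫ x in D, (η x * fderiv ℝ φ x (EuclideanSpace.single i 1)) • u x := by
    congr 1; ext x; simp only [Complex.real_smul, smul_eq_mul, Complex.ofReal_mul]; ring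
  have r : ∫ x in D, φ x • ((η x : ℂ) • g x + u x • gradC η x) i =
      (∫ x in D, (φ x * η x) • g x i) +
        ∫ x in D, (φ x * fderiv ℝ η x (EuclideanSpace.single i 1)) • u x := by
    rw [← integral_add i3 i1]
    congr 1; ext x
    simp only [Complex.real_smul, PiLp.add_apply, PiLp.smul_apply, smul_eq_mul, gradC_apply,
      Complex.ofReal_mul]
    ring
  rw [l, r, eq_sub_of_add_eq' e]
  ring

theorem isWeakGradient_congr {u u' : EuclideanSpace ℝ (Fin n) → ℂ}
    {g g' : EuclideanSpace ℝ (Fin n) → EuclideanSpace ℂ (Fin n)}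
    (h : IsWeakGradient D u g) (hu : u' =ᵐ[volume.restrict D] u)
    (hg : g' =ᵐ[volume.restrict D] g) : IsWeakGradient D u' g' := by
  intro φ hφ hc hs i
  rw [integral_congr_ae (g := fun x => fderiv ℝ φ x (EuclideanSpace.single i 1) • u x)
      (by filter_upwards [hu] with x hx; rw [hx]),
    integral_congr_ae (f := fun x => φ x • g' x i) (g := fun x => φ x • g x i)
      (by filter_upwards [hg] with x hx; rw [hx])]
  exact h φ hφ hc hs i

/-- Multiplication by a smooth function is a bounded operator on `W^{1,2}(D)` if `D` is bounded. -/
theorem exists_mulW12 (hD : MeasurableSet D) (hb : Bornology.IsBounded D)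
    {η : EuclideanSpace ℝ (Fin n) → ℝ} (hη : ContDiff ℝ ∞ η) :
    ∃ M : W12 D →L[ℂ] W12 D, ∀ u,
      sobFn (M u) =ᵐ[volume.restrict D] (fun x => (η x : ℂ) • sobFn u x) ∧
      sobGrad (M u) =ᵐ[volume.restrict D]
        fun x => (η x : ℂ) • sobGrad u x + sobFn u x • gradC η x := by
  have hη' : MemLp (fun x => (η x : ℂ)) ∞ (volume.restrict D) :=
    memLp_top_restrict_of_continuous hD hb _ (Complex.continuous_ofReal.comp hη.continuous)
  obtain ⟨M₁, h₁⟩ := exists_mulLp (G := ℂ) (p := 2) hη'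
  obtain ⟨M₂, h₂⟩ := exists_mulLp (G := EuclideanSpace ℂ (Fin n)) (p := 2) hη'
  obtain ⟨M₃, h₃⟩ := exists_mulVecLp (p := 2)
    (memLp_top_restrict_of_continuous hD hb volume (continuous_gradC hη))
  let pf : W12 D →L[ℂ] L2 D := (WithLp.fstL 2 ℂ (L2 D) (L2Vec D)).comp (W12 D).subtypeL
  let pg : W12 D →L[ℂ] L2Vec D := (WithLp.sndL 2 ℂ (L2 D) (L2Vec D)).comp (W12 D).subtypeL
  -- The pair (ηu, η∇u + u∇η), at first only in the ambient product space.
  let T : W12 D →L[ℂ] WithLp 2 (L2 D × L2Vec D) :=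
    (WithLp.prodContinuousLinearEquiv 2 ℂ (L2 D) (L2Vec D)).symm.toContinuousLinearMap.comp
      ((M₁.comp pf).prod (M₂.comp pg + M₃.comp pf))
  have hfst (u : W12 D) : (T u).fst =ᵐ[volume.restrict D] fun x => (η x : ℂ) • sobFn u x :=
    h₁ (sobFn u)
  have hsnd (u : W12 D) : (T u).snd =ᵐ[volume.restrict D]
      fun x => (η x : ℂ) • sobGrad u x + sobFn u x • gradC η x := by
    change (M₂ (sobGrad u) + M₃ (sobFn u) : L2Vec D) =ᵐ[volume.restrict D] _
    filter_upwards [h₂ (sobGrad u), h₃ (sobFn u),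
      Lp.coeFn_add (M₂ (sobGrad u)) (M₃ (sobFn u))] with x e₂ e₃ e
    rw [e, Pi.add_apply, e₂, e₃]
  have hT (u : W12 D) : T u ∈ W12 D :=
    isWeakGradient_congr (isWeakGradient_mul (Lp.memLp (sobFn u)) (memLp_coord (sobGrad u)) u.2 hη)
      (hfst u) (hsnd u)
  exact ⟨T.codRestrict (W12 D) hT, fun u => ⟨hfst u, hsnd u⟩⟩

end Sobolev

/-! ### The trace and smooth multipliers -/

section Trace

variable {n : ℕ} {D Γ : Set (EuclideanSpace ℝ (Fin n))}

/-- `extendOfNorm` takes the default value 0 when the range is not dense or no norm bound holds. An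
identity that is trivial for the zero map may therefore be proved as if the extension were genuine.
-/
theorem extendOfNorm_eq_zero_or {V W X : Type*} [AddCommGroup V] [Module ℂ V]
    [NormedAddCommGroup W] [NormedSpace ℂ W] [NormedAddCommGroup X] [NormedSpace ℂ X]
    [CompleteSpace X] (f : V →ₗ[ℂ] X) (e : V →ₗ[ℂ] W) :
    f.extendOfNorm e = 0 ∨ (DenseRange e ∧ ∀ w, f.extendOfNorm e (e w) = f w) := by
  by_cases hd : DenseRange e
  · by_cases hn : ∃ C : ℝ, ∀ x, ‖f x‖ ≤ C * ‖e x‖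
    · exact .inr ⟨hd, fun w => LinearMap.extendOfNorm_eq hd hn w⟩
    · left
      have h0 : f.compLeftInverse e = 0 := by
        simp only [LinearMap.compLeftInverse, hn, dite_false]
      rw [LinearMap.extendOfNorm, h0]
      exact ContinuousLinearMap.extend_zero (by simpa using! hd)
        isUniformEmbedding_subtype_val.isUniformInducing
  · left
    have hd' : ¬ DenseRange (LinearMap.range e).subtypeL := by
      simpa using! hd
    rw [LinearMap.extendOfNorm, ContinuousLinearMap.extend, dif_neg (fun h => hd' h.1)]

/-- The trace operator commutes with multiplication by smooth functions. -/
theorem trace_mul (hb : Bornology.IsBounded D) (hΓ : MeasurableSet Γ) (hΓD : Γ ⊆ closure D)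
    (d : ℝ) (q : ℝ≥0∞) [Fact (1 ≤ q)] {η : EuclideanSpace ℝ (Fin n) → ℝ} (hη : Continuous η)
    {M : W12 D →L[ℂ] W12 D}
    (hM : ∀ u, sobFn (M u) =ᵐ[volume.restrict D] (fun x => (η x : ℂ) • sobFn u x)) (u : W12 D) :
    trace D Γ d q (M u) =ᵐ[surf d Γ] fun x => (η x : ℂ) • trace D Γ d q u x := by
  have hc : Continuous fun x => (η x : ℂ) := Complex.continuous_ofReal.comp hη
  have hη' : MemLp (fun x => (η x : ℂ)) ∞ (surf d Γ) :=
    memLp_top_restrict_of_continuous hΓ (hb.closure.subset hΓD) _ hc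
  obtain ⟨m, hm⟩ := exists_mulLp (G := ℂ) (p := q) hη'
  suffices h : (trace D Γ d q).comp M = m.comp (trace D Γ d q) by
    rw [show trace D Γ d q (M u) = m (trace D Γ d q u) from DFunLike.congr_fun h u]
    exact hm _
  rcases extendOfNorm_eq_zero_or (restrictToBoundary D Γ d q) (contInclusion D Γ d q)
    with h0 | ⟨hd, he⟩
  · rw [trace, h0, ContinuousLinearMap.zero_comp, ContinuousLinearMap.comp_zero]
  -- Both sides are continuous, so it suffices to compare them on the dense class of functions
  -- continuous up to the boundary, which multiplication by η preserves.
  refine ContinuousLinearMap.coeFn_injective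
    (hd.equalizer (ContinuousLinearMap.continuous _) (ContinuousLinearMap.continuous _) ?_)
  funext w
  obtain ⟨⟨v, φ⟩, h1, h2, h3⟩ := w
  have hw' : (M v, fun x => (η x : ℂ) • φ x) ∈ contW12 D Γ d q := by
    refine ⟨hc.continuousOn.smul h1, ?_, h3.smul hη'⟩
    filter_upwards [hM v, h2] with x e1 e2
    rw [e1, e2]
  have key := he ⟨_, hw'⟩
  have key2 := he ⟨(v, φ), h1, h2, h3⟩
  change trace D Γ d q (M v) = MemLp.toLp (fun x => (η x : ℂ) • φ x) hw'.2.2 at key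
  change trace D Γ d q v = MemLp.toLp φ h3 at key2
  change trace D Γ d q (M v) = m (trace D Γ d q v)
  rw [key, key2]
  refine Lp.ext ?_
  filter_upwards [hm (MemLp.toLp φ h3), MemLp.coeFn_toLp h3, MemLp.coeFn_toLp hw'.2.2]
    with x e1 e2 e3
  rw [e1, e2, e3]

end Trace

/-! ### Smoothing the distance function -/

section SmoothDistance

open scoped Convolution

variable {n : ℕ}

/-- A `1`-Lipschitz function is uniformly approximated by smooth `1`-Lipschitz functions. -/
theorem exists_smooth_lipschitz_approx {f : EuclideanSpace ℝ (Fin n) → ℝ}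
    (hf : LipschitzWith 1 f) {δ : ℝ} (hδ : 0 < δ) :
    ∃ ψ : EuclideanSpace ℝ (Fin n) → ℝ, ContDiff ℝ ∞ ψ ∧ LipschitzWith 1 ψ ∧
      ∀ x, |ψ x - f x| ≤ δ := by
  -- Convolution with a probability density supported in the δ-ball averages translates of f: the
  -- Lipschitz constant is kept and values move by at most δ. The inner radius δ / 2 is immaterial.
  let φ : ContDiffBump (0 : EuclideanSpace ℝ (Fin n)) := ⟨δ / 2, δ, half_pos hδ, half_lt_self hδ⟩
  have hli : LocallyIntegrable f := hf.continuous.locallyIntegrable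
  have hce : ConvolutionExists (φ.normed volume) f (ContinuousLinearMap.lsmul ℝ ℝ) volume :=
    φ.hasCompactSupport_normed.convolutionExists_left _ φ.continuous_normed hli
  refine ⟨φ.normed volume ⋆[ContinuousLinearMap.lsmul ℝ ℝ, volume] f,
    φ.hasCompactSupport_normed.contDiff_convolution_left _ φ.contDiff_normed hli,
    LipschitzWith.of_dist_le_mul fun x y => ?_, fun x => ?_⟩
  · have hx : Integrable (fun t => φ.normed volume t • f (x - t)) := hce x
    have hy : Integrable (fun t => φ.normed volume t • f (y - t)) := hce y
    rw [NNReal.coe_one, one_mul, dist_eq_norm]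
    simp only [convolution_def, ContinuousLinearMap.lsmul_apply]
    rw [← integral_sub hx hy]
    calc ‖∫ t, (φ.normed volume t • f (x - t) - φ.normed volume t • f (y - t))‖
        ≤ ∫ t, φ.normed volume t * dist x y := by
          refine norm_integral_le_of_norm_le (φ.integrable_normed.mul_const _)
            (.of_forall fun t => ?_)
          rw [← smul_sub, norm_smul, Real.norm_of_nonneg (φ.nonneg_normed t), ← dist_eq_norm]
          refine mul_le_mul_of_nonneg_left ?_ (φ.nonneg_normed t)
          simpa using hf.dist_le_mul (x - t) (y - t)
      _ = dist x y := by rw [integral_mul_const, φ.integral_normed, one_mul]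
  · rw [← Real.dist_eq]
    refine ContDiffBump.dist_normed_convolution_le hf.continuous.aestronglyMeasurable
      fun y hy => ?_
    have h1 := hf.dist_le_mul y x
    rw [NNReal.coe_one, one_mul] at h1
    exact h1.trans (Metric.mem_ball.1 hy).le

/-- Distances to F and to its closure agree. Points of the closure are needed because the trace is
estimated on closure F ∩ Γ. -/
theorem setDist_le_infDist {E F : Set (EuclideanSpace ℝ (Fin n))}
    {x : EuclideanSpace ℝ (Fin n)} (hx : x ∈ closure F) : setDist E F ≤ Metric.infDist x E := by
  rcases E.eq_empty_or_nonempty with rfl | hE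
  -- For empty E both sides take the default value 0.
  · simp [setDist]
  refine ENNReal.toReal_mono (Metric.infEDist_ne_top hE) ?_
  rw [Metric.infEDist]
  refine iInf₂_mono fun y _ => ?_
  rw [edist_comm, ← Metric.infEDist_closure]
  exact Metric.infEDist_le_edist_of_mem hx

end SmoothDistance

/-! ### The Lax-Milgram theorem -/

section LaxMilgram

variable {V : Type*} [NormedAddCommGroup V] [InnerProductSpace ℂ V] [CompleteSpace V]

/-- By Cauchy-Schwarz, coercivity bounds T from below, so T is injective with closed range. A vector
w orthogonal to the range is orthogonal to T w, hence zero by coercivity. -/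
theorem bijective_of_coercive (T : V →L[ℂ] V) {c : ℝ} (hc : 0 < c)
    (h : ∀ u, c * ‖u‖ ^ 2 ≤ (inner ℂ u (T u)).re) : Function.Bijective T := by
  have hb (u : V) : c * ‖u‖ ≤ ‖T u‖ := by
    rcases eq_or_ne u 0 with rfl | hu
    · simp
    have hu' : 0 < ‖u‖ := norm_pos_iff.2 hu
    refine le_of_mul_le_mul_left ?_ hu'
    calc ‖u‖ * (c * ‖u‖) = c * ‖u‖ ^ 2 := by ring
      _ ≤ (inner ℂ u (T u)).re := h u
      _ ≤ ‖u‖ * ‖T u‖ := (Complex.re_le_norm _).trans (norm_inner_le_norm _ _)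
  have ha : AntilipschitzWith (c⁻¹).toNNReal T := by
    refine T.antilipschitz_of_bound fun u => ?_
    rw [Real.coe_toNNReal _ (inv_nonneg.2 hc.le), ← div_eq_inv_mul, le_div_iff₀ hc, mul_comm]
    exact hb u
  refine ⟨ha.injective, LinearMap.range_eq_top.1 ?_⟩
  have hcl : IsClosed (T.range : Set V) := ha.isClosed_range T.uniformContinuous
  have := hcl.completeSpace_coe
  change T.range = ⊤
  rw [← T.range.orthogonal_orthogonal, Submodule.eq_top_iff']
  intro v w hw
  have hw0 : inner ℂ w (T w) = 0 := (Submodule.mem_orthogonal' _ _).1 hw _ ⟨w, rfl⟩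
  have h0 := h w
  rw [hw0, Complex.zero_re] at h0
  have : w = 0 := by
    rw [← norm_eq_zero, ← sq_eq_zero_iff]
    nlinarith [sq_nonneg ‖w‖]
  rw [this, inner_zero_left]

/-- A bounded sesquilinear form is given by a bounded operator. -/
theorem exists_operator_of_form (a : V → V → ℂ) (hal : ∀ u u' v, a (u + u') v = a u v + a u' v)
    (hsl : ∀ (z : ℂ) u v, a (z • u) v = z * a u v)
    (har : ∀ u v v', a u (v + v') = a u v + a u v')
    (hsr : ∀ (z : ℂ) u v, a u (z • v) = conj z * a u v)
    {C : ℝ} (hC : ∀ u v, ‖a u v‖ ≤ C * ‖u‖ * ‖v‖) :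
    ∃ T : V →L[ℂ] V, ∀ u v, a u v = inner ℂ v (T u) := by
  -- The conjugate makes the form antilinear in its first and linear in its second variable,
  -- matching the inner product.
  let B : V →ₗ⋆[ℂ] V →ₗ[ℂ] ℂ := LinearMap.mk₂'ₛₗ (starRingEnd ℂ) (RingHom.id ℂ)
    (fun u v => conj (a u v)) (fun u u' v => by simp [hal]) (fun z u v => by simp [hsl])
    (fun u v v' => by simp [har]) (fun z u v => by simp [hsr])
  refine ⟨InnerProductSpace.continuousLinearMapOfBilin
    (B.mkContinuous₂ C fun u v => by simpa [B] using hC u v), fun u v => ?_⟩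
  rw [← inner_conj_symm, InnerProductSpace.continuousLinearMapOfBilin_apply]
  simp [B]

/-- The Lax-Milgram theorem for sesquilinear forms. -/
theorem existsUnique_of_coercive_form (a : V → V → ℂ)
    (hal : ∀ u u' v, a (u + u') v = a u v + a u' v)
    (hsl : ∀ (z : ℂ) u v, a (z • u) v = z * a u v)
    (har : ∀ u v v', a u (v + v') = a u v + a u v')
    (hsr : ∀ (z : ℂ) u v, a u (z • v) = conj z * a u v)
    {C : ℝ} (hC : ∀ u v, ‖a u v‖ ≤ C * ‖u‖ * ‖v‖) {c : ℝ} (hc : 0 < c)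
    (h : ∀ u, c * ‖u‖ ^ 2 ≤ (a u u).re) (F : V) : ∃! u, ∀ v, a u v = inner ℂ v F := by
  obtain ⟨T, hT⟩ := exists_operator_of_form a hal hsl har hsr hC
  obtain ⟨u, hu, huu⟩ := (bijective_of_coercive T hc fun u => by rw [← hT]; exact h u).existsUnique F
  refine ⟨u, fun v => by rw [hT, hu], fun u' hu' => huu u' ?_⟩
  exact ext_inner_left ℂ fun v => by rw [← hT, hu']

end LaxMilgram

/-! ### Completeness of W^{1,2}(D) -/

section Complete

variable {n : ℕ} {D : Set (EuclideanSpace ℝ (Fin n))}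

/-- Each identity defining the weak gradient equates two L²-continuous functionals, namely pairings
with compactly supported test functions. -/
theorem isClosed_W12 : IsClosed (W12 D : Set (WithLp 2 (L2 D × L2Vec D))) := by
  have hset : (W12 D : Set (WithLp 2 (L2 D × L2Vec D))) =
      ⋂ (φ : EuclideanSpace ℝ (Fin n) → ℝ) (_ : ContDiff ℝ ∞ φ) (_ : HasCompactSupport φ)
        (_ : tsupport φ ⊆ D) (i : Fin n), {w : WithLp 2 (L2 D × L2Vec D) |
          ∫ x in D, fderiv ℝ φ x (EuclideanSpace.single i 1) • w.fst x =
            - ∫ x in D, φ x • w.snd x i} := by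
    ext w
    simp only [Set.mem_iInter]
    rfl
  rw [hset]
  refine isClosed_iInter fun φ => isClosed_iInter fun hφ => isClosed_iInter fun hc =>
    isClosed_iInter fun _ => isClosed_iInter fun i => ?_
  have pairing {ψ : EuclideanSpace ℝ (Fin n) → ℝ} (hψ : Continuous ψ) (hcψ : HasCompactSupport ψ) :
      Continuous fun u : L2 D => ∫ x in D, ψ x • u x := by
    have hm : MemLp (fun x => (ψ x : ℂ)) 2 (volume.restrict D) :=
      (Complex.continuous_ofReal.comp hψ).memLp_of_hasCompactSupport
        (hcψ.comp_left Complex.ofReal_zero)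
    have he (u : L2 D) : ∫ x in D, ψ x • u x = inner ℂ hm.toLp u := by
      rw [L2.inner_def]
      refine integral_congr_ae ?_
      filter_upwards [hm.coeFn_toLp] with x hx
      rw [hx, RCLike.inner_apply, Complex.conj_ofReal, Complex.real_smul, mul_comm]
    simp only [he]
    exact continuous_const.inner continuous_id
  refine isClosed_eq ?_ ?_
  · have cφ : Continuous fun x => fderiv ℝ φ x (EuclideanSpace.single i 1) :=
      (hφ.continuous_fderiv (by simp)).clm_apply continuous_const
    have hcφ : HasCompactSupport fun x => fderiv ℝ φ x (EuclideanSpace.single i 1) :=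
      hc.fderiv_apply ℝ _
    exact (pairing cφ hcφ).comp (WithLp.fstL 2 ℂ (L2 D) (L2Vec D)).continuous
  · let π : EuclideanSpace ℂ (Fin n) →L[ℂ] ℂ := EuclideanSpace.proj i
    have h := (pairing hφ.continuous hc).comp
      ((π.compLpL 2 (volume.restrict D)).comp
        (WithLp.sndL 2 ℂ (L2 D) (L2Vec D))).continuous
    refine h.neg.congr fun w => ?_
    refine congrArg Neg.neg (integral_congr_ae (μ := volume.restrict D) (G := ℂ) ?_)
    filter_upwards [π.coeFn_compLpL (μ := volume.restrict D) (p := 2) w.snd] with x hx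
    exact congrArg (φ x • ·) hx

instance : CompleteSpace (W12 D) := isClosed_W12.completeSpace_coe

end Complete

/-! ### The Robin form and its resolvent -/

section Form

variable {n : ℕ} {D Γ : Set (EuclideanSpace ℝ (Fin n))}

theorem exists_coeffOp {A : EuclideanSpace ℝ (Fin n) → Matrix (Fin n) (Fin n) ℂ} {Λ : ℝ≥0}
    (hA : MemLp (coeff A) ∞ (volume.restrict D))
    (hΛ : eLpNorm (coeff A) ∞ (volume.restrict D) ≤ Λ) :
    ∃ N : L2Vec D →L[ℂ] L2Vec D,
      (∀ g, N g =ᵐ[volume.restrict D] fun x => coeff A x (g x)) ∧ ∀ g, ‖N g‖ ≤ Λ * ‖g‖ := by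
  let B := ContinuousLinearMap.id ℂ (EuclideanSpace ℂ (Fin n) →L[ℂ] EuclideanSpace ℂ (Fin n))
  refine ⟨B.holderL (volume.restrict D) ∞ 2 2 hA.toLp, fun g => ?_, fun g => ?_⟩
  · filter_upwards [B.coeFn_holder (r := 2) hA.toLp g, hA.coeFn_toLp] with x h1 h2
    rw [ContinuousLinearMap.holderL_apply_apply, h1, h2]
    rfl
  · refine (B.norm_holder_apply_apply_le hA.toLp g).trans ?_
    refine mul_le_mul_of_nonneg_right ?_ (norm_nonneg _)
    calc ‖B‖ * ‖hA.toLp‖ ≤ 1 * Λ := by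
          refine mul_le_mul ContinuousLinearMap.norm_id_le ?_ (norm_nonneg _) zero_le_one
          rw [Lp.norm_toLp]
          exact ENNReal.toReal_le_of_le_ofReal Λ.2 (by simpa using hΛ)
      _ = Λ := one_mul _

section Boundary

variable {μ : Measure (EuclideanSpace ℝ (Fin n))} {q q' : ℝ≥0∞}
  {b : EuclideanSpace ℝ (Fin n) → ℂ}

/-- Hölder's inequality twice: first for b φ, then against ψ. The hypothesis `hq` says that the
three exponents combine to 1. -/
theorem eLpNorm_weighted_le (hq : q'⁻¹ + 2 * q⁻¹ = 1) (hb : MemLp b q' μ)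
    {φ ψ : EuclideanSpace ℝ (Fin n) → ℂ} (hφ : MemLp φ q μ) (hψ : MemLp ψ q μ) :
    eLpNorm (fun x => b x * φ x * conj (ψ x)) 1 μ ≤
      eLpNorm b q' μ * eLpNorm φ q μ * eLpNorm ψ q μ := by
  have : ENNReal.HolderTriple q' q (q'⁻¹ + q⁻¹)⁻¹ := ⟨by rw [inv_inv]⟩
  have : ENNReal.HolderTriple (q'⁻¹ + q⁻¹)⁻¹ q 1 :=
    ⟨by rw [inv_inv, add_assoc, ← two_mul, hq, inv_one]⟩
  have hs : MemLp (star ψ) q μ := hψ.star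
  have h1 : eLpNorm (b • φ) (q'⁻¹ + q⁻¹)⁻¹ μ ≤ eLpNorm b q' μ * eLpNorm φ q μ :=
    eLpNorm_smul_le_mul_eLpNorm hφ.1 hb.1
  have h2 : eLpNorm ((b • φ) • star ψ) 1 μ ≤
      eLpNorm (b • φ) (q'⁻¹ + q⁻¹)⁻¹ μ * eLpNorm (star ψ) q μ :=
    eLpNorm_smul_le_mul_eLpNorm hs.1 (hb.1.smul hφ.1)
  rw [eLpNorm_star] at h2
  exact h2.trans (mul_le_mul_left h1 _)

theorem integrable_weighted (hq : q'⁻¹ + 2 * q⁻¹ = 1) (hb : MemLp b q' μ)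
    {φ ψ : EuclideanSpace ℝ (Fin n) → ℂ} (hφ : MemLp φ q μ) (hψ : MemLp ψ q μ) :
    Integrable (fun x => b x * φ x * conj (ψ x)) μ := by
  refine memLp_one_iff_integrable.1 ⟨(hb.1.mul hφ.1).mul hψ.star.1, ?_⟩
  exact (eLpNorm_weighted_le hq hb hφ hψ).trans_lt
    (ENNReal.mul_lt_top (ENNReal.mul_lt_top hb.2 hφ.2) hψ.2)

theorem norm_integral_weighted_le (hq : q'⁻¹ + 2 * q⁻¹ = 1) (hb : MemLp b q' μ)
    (φ ψ : Lp ℂ q μ) :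
    ‖∫ x, b x * φ x * conj (ψ x) ∂μ‖ ≤ (eLpNorm b q' μ).toReal * ‖φ‖ * ‖ψ‖ := by
  have h := eLpNorm_weighted_le hq hb (Lp.memLp φ) (Lp.memLp ψ)
  rw [eLpNorm_one_eq_lintegral_enorm] at h
  have h' := (enorm_integral_le_lintegral_enorm _).trans h
  rw [Lp.norm_def, Lp.norm_def, ← ENNReal.toReal_mul, ← ENNReal.toReal_mul, ← toReal_enorm]
  exact ENNReal.toReal_mono (ENNReal.mul_ne_top (ENNReal.mul_ne_top hb.2.ne (Lp.memLp φ).2.ne)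
    (Lp.memLp ψ).2.ne) h'

end Boundary

variable {d : ℝ} {q q' : ℝ≥0∞} [Fact (1 ≤ q)]
  {A : EuclideanSpace ℝ (Fin n) → Matrix (Fin n) (Fin n) ℂ} {b : EuclideanSpace ℝ (Fin n) → ℂ}

theorem integral_coeff_eq {N : L2Vec D →L[ℂ] L2Vec D}
    (hN : ∀ g, N g =ᵐ[volume.restrict D] fun x => coeff A x (g x)) (g h : L2Vec D) :
    ∫ x in D, inner ℂ (h x) (coeff A x (g x)) = inner ℂ h (N g) := by
  rw [L2.inner_def]
  refine integral_congr_ae ?_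
  filter_upwards [hN g] with x hx
  rw [hx]

theorem robinForm_eq {N : L2Vec D →L[ℂ] L2Vec D}
    (hN : ∀ g, N g =ᵐ[volume.restrict D] fun x => coeff A x (g x)) (u v : W12 D) :
    robinForm D Γ d q A b u v = inner ℂ (sobGrad v) (N (sobGrad u)) +
      ∫ x, b x * trace D Γ d q u x * conj (trace D Γ d q v x) ∂(surf d Γ) := by
  rw [robinForm, integral_coeff_eq hN]

/-- The image g = Lu is determined by u as t⁻² (f - u); eliminating it leaves the weak formulation.
-/
theorem isRobinResolvent_iff {t : ℝ} (ht : 0 < t) {f : L2 D} {u : W12 D} :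
    IsRobinResolvent D Γ d q A b t f u ↔ ∀ v : W12 D,
      inner ℂ (sobFn v) (sobFn u) + ((t ^ 2 : ℝ) : ℂ) * robinForm D Γ d q A b u v =
        inner ℂ (sobFn v) f := by
  have ht' : ((t ^ 2 : ℝ) : ℂ) ≠ 0 := Complex.ofReal_ne_zero.2 (by positivity)
  have hi (g : L2 D) (v : W12 D) :
      ∫ x in D, g x * conj (sobFn v x) = inner ℂ (sobFn v) g := by
    rw [L2.inner_def]; rfl
  constructor
  · rintro ⟨g, hg, rfl⟩ v
    rw [hg v, hi, inner_add_right, inner_smul_right]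
  · intro h
    refine ⟨((t ^ 2 : ℝ) : ℂ)⁻¹ • (f - sobFn u), fun v => ?_, ?_⟩
    · rw [hi, inner_smul_right, inner_sub_right, ← h v]
      field_simp
      ring
    · rw [smul_inv_smul₀ ht']
      abel

/-- Lax-Milgram applies with coercivity constant t²λ, the mass term being nonnegative. The adjoint
of the inclusion into L² represents the right-hand side. -/
theorem existsUnique_isRobinResolvent {Λ : ℝ≥0} (hq : q'⁻¹ + 2 * q⁻¹ = 1)
    (hA : MemLp (coeff A) ∞ (volume.restrict D))
    (hΛ : eLpNorm (coeff A) ∞ (volume.restrict D) ≤ Λ) (hb : MemLp b q' (surf d Γ))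
    {lam : ℝ} (hlam : 0 < lam)
    (hco : ∀ u : W12 D, lam * ‖u‖ ^ 2 ≤ (robinForm D Γ d q A b u u).re)
    {t : ℝ} (ht : 0 < t) (f : L2 D) : ∃! u : W12 D, IsRobinResolvent D Γ d q A b t f u := by
  obtain ⟨N, hN, hNΛ⟩ := exists_coeffOp hA hΛ
  set τ := trace D Γ d q
  let G : W12 D →L[ℂ] L2Vec D := (WithLp.sndL 2 ℂ (L2 D) (L2Vec D)).comp (W12 D).subtypeL
  let J : W12 D →L[ℂ] L2 D := (WithLp.fstL 2 ℂ (L2 D) (L2Vec D)).comp (W12 D).subtypeL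
  let β : W12 D → W12 D → ℂ := fun u v => ∫ x, b x * τ u x * conj (τ v x) ∂(surf d Γ)
  have hint (u v : W12 D) : Integrable (fun x => b x * τ u x * conj (τ v x)) (surf d Γ) :=
    integrable_weighted hq hb (Lp.memLp _) (Lp.memLp _)
  let a : W12 D → W12 D → ℂ := fun u v =>
    inner ℂ (J v) (J u) + ((t ^ 2 : ℝ) : ℂ) * (inner ℂ (G v) (N (G u)) + β u v)
  have haf (u v : W12 D) : a u v =
      inner ℂ (sobFn v) (sobFn u) + ((t ^ 2 : ℝ) : ℂ) * robinForm D Γ d q A b u v := by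
    rw [robinForm_eq hN]; rfl
  have hβal (u u' v : W12 D) : β (u + u') v = β u v + β u' v := by
    simp only [β]
    rw [← integral_add (hint u v) (hint u' v)]
    refine integral_congr_ae ?_
    rw [map_add]
    filter_upwards [Lp.coeFn_add (τ u) (τ u')] with x hx
    rw [hx, Pi.add_apply]; ring
  have hβar (u v v' : W12 D) : β u (v + v') = β u v + β u v' := by
    simp only [β]
    rw [← integral_add (hint u v) (hint u v')]
    refine integral_congr_ae ?_
    rw [map_add]
    filter_upwards [Lp.coeFn_add (τ v) (τ v')] with x hx
    rw [hx, Pi.add_apply, map_add]; ring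
  have hβsl (z : ℂ) (u v : W12 D) : β (z • u) v = z * β u v := by
    simp only [β]
    rw [← integral_const_mul]
    refine integral_congr_ae ?_
    rw [map_smul]
    filter_upwards [Lp.coeFn_smul z (τ u)] with x hx
    rw [hx, Pi.smul_apply, smul_eq_mul]; ring
  have hβsr (z : ℂ) (u v : W12 D) : β u (z • v) = conj z * β u v := by
    simp only [β]
    rw [← integral_const_mul]
    refine integral_congr_ae ?_
    rw [map_smul]
    filter_upwards [Lp.coeFn_smul z (τ v)] with x hx
    rw [hx, Pi.smul_apply, smul_eq_mul, map_mul]; ring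
  have hbound (u v : W12 D) : ‖a u v‖ ≤
      (1 + t ^ 2 * (Λ + (eLpNorm b q' (surf d Γ)).toReal * ‖τ‖ * ‖τ‖)) * ‖u‖ * ‖v‖ := by
    have e1 : ‖inner ℂ (J v) (J u)‖ ≤ ‖v‖ * ‖u‖ :=
      (norm_inner_le_norm _ _).trans
        (mul_le_mul (norm_sobFn_le v) (norm_sobFn_le u) (norm_nonneg _) (norm_nonneg _))
    have e2 : ‖inner ℂ (G v) (N (G u))‖ ≤ ‖v‖ * (Λ * ‖u‖) :=
      (norm_inner_le_norm _ _).trans (mul_le_mul (norm_sobGrad_le v)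
        ((hNΛ _).trans (mul_le_mul_of_nonneg_left (norm_sobGrad_le u) Λ.2))
        (norm_nonneg _) (norm_nonneg _))
    have e3 : ‖β u v‖ ≤ (eLpNorm b q' (surf d Γ)).toReal * (‖τ‖ * ‖u‖) * (‖τ‖ * ‖v‖) :=
      (norm_integral_weighted_le hq hb (τ u) (τ v)).trans (by
        gcongr <;> exact τ.le_opNorm _)
    calc ‖a u v‖ ≤ ‖inner ℂ (J v) (J u)‖ + t ^ 2 * (‖inner ℂ (G v) (N (G u))‖ + ‖β u v‖) := by
          refine (norm_add_le _ _).trans (add_le_add le_rfl ?_)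
          rw [norm_mul, Complex.norm_of_nonneg (sq_nonneg t)]
          exact mul_le_mul_of_nonneg_left (norm_add_le _ _) (sq_nonneg t)
      _ ≤ ‖v‖ * ‖u‖ + t ^ 2 * (‖v‖ * (Λ * ‖u‖) +
            (eLpNorm b q' (surf d Γ)).toReal * (‖τ‖ * ‖u‖) * (‖τ‖ * ‖v‖)) := by gcongr
      _ = _ := by ring
  have hcoer (u : W12 D) : t ^ 2 * lam * ‖u‖ ^ 2 ≤ (a u u).re := by
    rw [haf, Complex.add_re, Complex.re_ofReal_mul]
    have h1 : 0 ≤ (inner ℂ (sobFn u) (sobFn u)).re := inner_self_nonneg (𝕜 := ℂ)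
    nlinarith [mul_le_mul_of_nonneg_left (hco u) (sq_nonneg t)]
  obtain ⟨u, hu, huu⟩ := existsUnique_of_coercive_form a
    (fun u u' v => by simp only [a, hβal, map_add, inner_add_right]; ring)
    (fun z u v => by simp only [a, hβsl, map_smul, inner_smul_right]; ring)
    (fun u v v' => by simp only [a, hβar, map_add, inner_add_left]; ring)
    (fun z u v => by simp only [a, hβsr, map_smul, inner_smul_left]; ring)
    hbound (by positivity : 0 < t ^ 2 * lam) hcoer (J.adjoint f)
  have hiff (w : W12 D) : IsRobinResolvent D Γ d q A b t f w ↔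
      ∀ v, a w v = inner ℂ v (J.adjoint f) := by
    rw [isRobinResolvent_iff ht]
    refine forall_congr' fun v => ?_
    rw [haf, ContinuousLinearMap.adjoint_inner_right]
    rfl
  exact ⟨u, (hiff u).2 hu, fun w hw => huu w ((hiff w).1 hw)⟩

end Form

/-! ### Exponential weights and off-diagonal decay -/

section OffDiagonal

variable {n : ℕ} {D Γ : Set (EuclideanSpace ℝ (Fin n))}

/-- Because the exponential reproduces itself, the error in the product rule for w = exp(sψ) u is w
∇(sψ), of size at most s |w| for 1-Lipschitz ψ however large ψ is. -/
theorem gradC_exp {ψ : EuclideanSpace ℝ (Fin n) → ℝ} (hψ : ContDiff ℝ ∞ ψ) (s : ℝ)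
    (x : EuclideanSpace ℝ (Fin n)) :
    gradC (fun x => Real.exp (s * ψ x)) x =
      ((Real.exp (s * ψ x) : ℝ) : ℂ) • gradC (fun x => s * ψ x) x := by
  have h : DifferentiableAt ℝ (fun x => s * ψ x) x :=
    (hψ.differentiable (by simp) x).const_mul s
  ext i
  rw [PiLp.smul_apply, gradC_apply, gradC_apply, fderiv_exp h]
  simp

/-- Davies' exponential perturbation: for a solution `u` of the resolvent equation, the weighted
function `w = exp (s ψ) u` satisfies an energy inequality with a lower order error term. -/
theorem exists_weighted_energy (hD : MeasurableSet D) (hb : Bornology.IsBounded D)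
    (hΓ : MeasurableSet Γ) (hΓD : Γ ⊆ closure D) {d : ℝ} {q : ℝ≥0∞} [Fact (1 ≤ q)]
    {A : EuclideanSpace ℝ (Fin n) → Matrix (Fin n) (Fin n) ℂ} {b : EuclideanSpace ℝ (Fin n) → ℂ}
    {Λ : ℝ≥0} (hA : MemLp (coeff A) ∞ (volume.restrict D))
    (hΛ : eLpNorm (coeff A) ∞ (volume.restrict D) ≤ Λ) {lam : ℝ}
    (hco : ∀ u : W12 D, lam * ‖u‖ ^ 2 ≤ (robinForm D Γ d q A b u u).re)
    {ψ : EuclideanSpace ℝ (Fin n) → ℝ} (hψ : ContDiff ℝ ∞ ψ) (hψ1 : LipschitzWith 1 ψ)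
    {s t : ℝ} (hs : 0 ≤ s) (ht : 0 < t) {f : L2 D} {u : W12 D}
    (hu : IsRobinResolvent D Γ d q A b t f u) {K : ℝ}
    (hf : ∀ᵐ x ∂(volume.restrict D), ‖((Real.exp (s * ψ x) : ℝ) : ℂ) • f x‖ ≤ K * ‖f x‖) :
    ∃ (w : W12 D) (P : L2Vec D),
      (sobFn w =ᵐ[volume.restrict D] fun x => ((Real.exp (s * ψ x) : ℝ) : ℂ) • sobFn u x) ∧
      ((sobGrad w - P : L2Vec D) =ᵐ[volume.restrict D]
        fun x => ((Real.exp (s * ψ x) : ℝ) : ℂ) • sobGrad u x) ∧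
      (trace D Γ d q w =ᵐ[surf d Γ]
        fun x => ((Real.exp (s * ψ x) : ℝ) : ℂ) • trace D Γ d q u x) ∧
      ‖P‖ ≤ s * ‖sobFn w‖ ∧
      ‖sobFn w‖ ^ 2 + t ^ 2 * (lam * ‖w‖ ^ 2 - 2 * Λ * ‖P‖ * ‖w‖ - Λ * ‖P‖ ^ 2) ≤
        K * ‖f‖ * ‖sobFn w‖ := by
  set η : EuclideanSpace ℝ (Fin n) → ℝ := fun x => Real.exp (s * ψ x)
  have hsψ : ContDiff ℝ ∞ fun x => s * ψ x := contDiff_const.mul hψ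
  have hη : ContDiff ℝ ∞ η := hsψ.exp
  obtain ⟨M, hM⟩ := exists_mulW12 hD hb hη
  have hMt := trace_mul hb hΓ hΓD d q hη.continuous fun v => (hM v).1
  obtain ⟨N, hN, hNΛ⟩ := exists_coeffOp hA hΛ
  have hθ : MemLp (gradC fun x => s * ψ x) ∞ (volume.restrict D) :=
    memLp_top_restrict_of_continuous hD hb volume (continuous_gradC hsψ)
  obtain ⟨mP, hmP⟩ := exists_mulVecLp (p := 2) hθ
  set w : W12 D := M u
  set P : L2Vec D := mP (sobFn w)
  have hw := (hM u).1
  have hP : P =ᵐ[volume.restrict D] fun x => sobFn w x • gradC (fun x => s * ψ x) x := hmP _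
  have hgrad : (sobGrad w - P : L2Vec D) =ᵐ[volume.restrict D]
      fun x => (η x : ℂ) • sobGrad u x := by
    filter_upwards [Lp.coeFn_sub (sobGrad w) P, (hM u).2, hw, hP] with x e1 e2 e3 e4
    rw [e1, Pi.sub_apply, e2, e4, e3, gradC_exp hψ, smul_eq_mul, mul_smul, smul_comm (sobFn u x)]
    exact add_sub_cancel_right _ _
  have hPn : ‖P‖ ≤ s * ‖sobFn w‖ := by
    refine Lp.norm_le_mul_norm_of_ae_le_mul ?_
    filter_upwards [hP] with x hx
    rw [hx, norm_smul, mul_comm s]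
    refine mul_le_mul_of_nonneg_left ((norm_gradC_le _ x).trans ?_) (norm_nonneg _)
    rw [fderiv_const_mul (hψ.differentiable (by simp) x), norm_smul, Real.norm_of_nonneg hs]
    have h1 : ‖fderiv ℝ ψ x‖ ≤ 1 := norm_fderiv_le_of_lipschitz ℝ hψ1
    simpa using mul_le_mul_of_nonneg_left h1 hs
  refine ⟨w, P, hw, hgrad, hMt u, hPn, ?_⟩
  -- the equation, tested with `η² u`
  have htest := (isRobinResolvent_iff ht).1 hu (M w)
  have hmass : inner ℂ (sobFn (M w)) (sobFn u) = inner ℂ (sobFn w) (sobFn w) := by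
    rw [L2.inner_def, L2.inner_def]
    refine integral_congr_ae ?_
    filter_upwards [(hM w).1, hw] with x e1 e2
    rw [e1, e2]
    simp only [RCLike.inner_apply, smul_eq_mul, map_mul, Complex.conj_ofReal]
    ring
  -- The pairs (u, η²u) and (ηu, ηu) give the same boundary integral, as η is real; no commutator
  -- term in b appears.
  have hbdry : ∫ x, b x * trace D Γ d q u x * conj (trace D Γ d q (M w) x) ∂(surf d Γ) =
      ∫ x, b x * trace D Γ d q w x * conj (trace D Γ d q w x) ∂(surf d Γ) := by
    refine integral_congr_ae ?_
    filter_upwards [hMt w, hMt u] with x e1 e2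
    rw [e1, e2]
    simp only [smul_eq_mul, map_mul, Complex.conj_ofReal]
    ring
  -- Here η∇u = ∇w - P and ∇(ηw) = η(∇w + P); the factor η is moved to the other side.
  have hgr : inner ℂ (sobGrad (M w)) (N (sobGrad u)) =
      inner ℂ (sobGrad w + P) (N (sobGrad w - P)) := by
    rw [L2.inner_def, L2.inner_def]
    refine integral_congr_ae ?_
    filter_upwards [(hM w).2, hP, hgrad, Lp.coeFn_add (sobGrad w) P, hN (sobGrad u),
      hN (sobGrad w - P)] with x e1 e2 e3 e4 e5 e6
    rw [e6, e3, e5, e4, Pi.add_apply, e1, e2, gradC_exp hψ, map_smul, smul_comm (sobFn w x),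
      ← smul_add, inner_smul_left, inner_smul_right, Complex.conj_ofReal]
  have hform : robinForm D Γ d q A b u (M w) = robinForm D Γ d q A b w w +
      (inner ℂ P (N (sobGrad w)) - inner ℂ (sobGrad w) (N P) - inner ℂ P (N P)) := by
    rw [robinForm_eq hN, robinForm_eq hN, hbdry, hgr, map_sub, inner_add_left, inner_sub_right,
      inner_sub_right]
    ring
  have hrhs : ‖inner ℂ (sobFn (M w)) f‖ ≤ K * ‖f‖ * ‖sobFn w‖ := by
    obtain ⟨m, hm⟩ := exists_mulLp (G := ℂ) (p := 2) (memLp_top_restrict_of_continuous hD hb volume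
      (Complex.continuous_ofReal.comp hη.continuous))
    have h1 : inner ℂ (sobFn (M w)) f = inner ℂ (sobFn w) (m f) := by
      rw [L2.inner_def, L2.inner_def]
      refine integral_congr_ae ?_
      filter_upwards [(hM w).1, hm f] with x e1 e2
      rw [e1, e2]
      simp only [RCLike.inner_apply, smul_eq_mul, map_mul, Complex.conj_ofReal,
        Function.comp_apply]
      ring
    have h2 : ‖m f‖ ≤ K * ‖f‖ := by
      refine Lp.norm_le_mul_norm_of_ae_le_mul ?_
      filter_upwards [hm f, hf] with x e1 e2
      rw [e1]
      exact e2
    rw [h1, mul_comm]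
    exact (norm_inner_le_norm _ _).trans (mul_le_mul_of_nonneg_left h2 (norm_nonneg _))
  have hre := congrArg Complex.re htest
  rw [hmass, hform, Complex.add_re, Complex.re_ofReal_mul, Complex.add_re, Complex.sub_re,
    Complex.sub_re] at hre
  have hm0 : (inner ℂ (sobFn w) (sobFn w)).re = ‖sobFn w‖ ^ 2 :=
    inner_self_eq_norm_sq (𝕜 := ℂ) _
  have b1 : |(inner ℂ P (N (sobGrad w))).re| ≤ Λ * ‖P‖ * ‖w‖ := by
    refine (Complex.abs_re_le_norm _).trans ((norm_inner_le_norm _ _).trans ?_)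
    calc ‖P‖ * ‖N (sobGrad w)‖ ≤ ‖P‖ * (Λ * ‖w‖) := by
          gcongr
          exact (hNΛ _).trans (by gcongr; exact norm_sobGrad_le w)
      _ = _ := by ring
  have b2 : |(inner ℂ (sobGrad w) (N P)).re| ≤ Λ * ‖P‖ * ‖w‖ := by
    refine (Complex.abs_re_le_norm _).trans ((norm_inner_le_norm _ _).trans ?_)
    calc ‖sobGrad w‖ * ‖N P‖ ≤ ‖w‖ * (Λ * ‖P‖) :=
          mul_le_mul (norm_sobGrad_le w) (hNΛ P) (norm_nonneg _) (norm_nonneg _)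
      _ = _ := by ring
  have b3 : |(inner ℂ P (N P)).re| ≤ Λ * ‖P‖ ^ 2 := by
    refine (Complex.abs_re_le_norm _).trans ((norm_inner_le_norm _ _).trans ?_)
    calc ‖P‖ * ‖N P‖ ≤ ‖P‖ * (Λ * ‖P‖) := by gcongr; exact hNΛ P
      _ = _ := by ring
  have hle : lam * ‖w‖ ^ 2 - 2 * Λ * ‖P‖ * ‖w‖ - Λ * ‖P‖ ^ 2 ≤
      (robinForm D Γ d q A b w w).re + ((inner ℂ P (N (sobGrad w))).re -
        (inner ℂ (sobGrad w) (N P)).re - (inner ℂ P (N P)).re) := by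
    linarith [hco w, (abs_le.1 b1).1, (abs_le.1 b2).2, (abs_le.1 b3).2]
  have hr := (Complex.re_le_norm _).trans hrhs
  rw [hm0] at hre
  linarith [mul_le_mul_of_nonneg_left hle (sq_nonneg t)]

/-- The energy inequality, with the error term absorbed. -/
theorem absorb_error {lam Λ X Y p s t c κ : ℝ} (hlam : 0 < lam) (hΛ : 0 ≤ Λ)
    (hp0 : 0 ≤ p) (ht : 0 < t) (hst : s * t = c) (hc : 0 ≤ c) (hc1 : c ≤ 1)
    (hcs : c * (2 * Λ ^ 2 / lam + Λ) ≤ 1 / 2) (hκ : 0 ≤ κ) (hp : p ≤ s * X)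
    (h : X ^ 2 + t ^ 2 * (lam * Y ^ 2 - 2 * Λ * p * Y - Λ * p ^ 2) ≤ κ * X) :
    X ≤ 2 * κ ∧ t * Y ≤ 2 / √lam * κ := by
  set Z := t * Y
  set r := t * p
  have hr0 : 0 ≤ r := mul_nonneg ht.le hp0
  have hr : r ≤ c * X := by
    calc t * p ≤ t * (s * X) := by gcongr
      _ = c * X := by rw [← hst]; ring
  have hE : X ^ 2 + lam * Z ^ 2 - 2 * Λ * r * Z - Λ * r ^ 2 ≤ κ * X := by
    calc _ = X ^ 2 + t ^ 2 * (lam * Y ^ 2 - 2 * Λ * p * Y - Λ * p ^ 2) := by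
          simp only [Z, r]; ring
      _ ≤ _ := h
  -- The difference of the two sides is a perfect square; half of the coercivity term is kept.
  have hyoung : 2 * Λ * r * Z ≤ lam / 2 * Z ^ 2 + 2 * Λ ^ 2 / lam * r ^ 2 := by
    have h0 : lam / 2 * Z ^ 2 + 2 * Λ ^ 2 / lam * r ^ 2 - 2 * Λ * r * Z =
        (lam * Z - 2 * Λ * r) ^ 2 / (2 * lam) := by
      field_simp
      ring
    have : 0 ≤ (lam * Z - 2 * Λ * r) ^ 2 / (2 * lam) := by positivity
    linarith
  -- From r ≤ cX comes a factor c²: one c is spent in `hcs`, the other is at most 1.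
  have hr2 : (2 * Λ ^ 2 / lam + Λ) * r ^ 2 ≤ 1 / 2 * X ^ 2 := by
    have hnn : 0 ≤ 2 * Λ ^ 2 / lam + Λ := by positivity
    calc (2 * Λ ^ 2 / lam + Λ) * r ^ 2 ≤ (2 * Λ ^ 2 / lam + Λ) * (c * X) ^ 2 := by gcongr
      _ = c * (2 * Λ ^ 2 / lam + Λ) * (c * X ^ 2) := by ring
      _ ≤ 1 / 2 * (1 * X ^ 2) := by gcongr
      _ = _ := by ring
  have hmain : X ^ 2 / 2 + lam / 2 * Z ^ 2 ≤ κ * X := by nlinarith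
  have hX2 : X ≤ 2 * κ := by
    have : 0 ≤ lam / 2 * Z ^ 2 := by positivity
    by_contra! hlt
    nlinarith
  refine ⟨hX2, ?_⟩
  have hsq : 0 < √lam := Real.sqrt_pos.2 hlam
  rw [div_mul_eq_mul_div, le_div_iff₀ hsq]
  refine le_of_sq_le_sq ?_ (by positivity)
  rw [mul_pow, Real.sq_sqrt hlam.le]
  nlinarith [sq_nonneg X]

/-- A weight that is bounded below on the support of a measure gives a weighted norm bound. -/
theorem eLpNorm_le_of_weight {μ ν : Measure (EuclideanSpace ℝ (Fin n))} (hμ : μ ≤ ν)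
    {G : Type*} [NormedAddCommGroup G] [NormedSpace ℂ G] {p : ℝ≥0∞} [Fact (1 ≤ p)]
    {h : EuclideanSpace ℝ (Fin n) → G} {k : Lp G p ν} {η : EuclideanSpace ℝ (Fin n) → ℝ}
    (hk : k =ᵐ[ν] fun x => (η x : ℂ) • h x) {m : ℝ} (hm0 : 0 ≤ m) (hm : ∀ᵐ x ∂μ, 1 ≤ m * η x) :
    eLpNorm h p μ ≤ ENNReal.ofReal (m * ‖k‖) := by
  have h1 : eLpNorm h p μ ≤ ENNReal.ofReal m * eLpNorm k p μ := by
    refine eLpNorm_le_mul_eLpNorm_of_ae_le_mul ?_ p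
    filter_upwards [hm, hk.filter_mono (ae_mono hμ)] with x e1 e2
    rw [e2, norm_smul, Complex.norm_real, ← mul_assoc]
    refine le_mul_of_one_le_left (norm_nonneg _) (e1.trans ?_)
    exact mul_le_mul_of_nonneg_left (Real.le_norm_self _) hm0
  refine h1.trans ?_
  rw [ENNReal.ofReal_mul hm0, Lp.norm_def, ENNReal.ofReal_toReal (Lp.memLp k).2.ne]
  gcongr

theorem eLpNorm_const_smul_le_of_weight {μ ν : Measure (EuclideanSpace ℝ (Fin n))} (hμ : μ ≤ ν)
    {G : Type*} [NormedAddCommGroup G] [NormedSpace ℂ G] [NormedSpace ℝ G] {p : ℝ≥0∞}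
    [Fact (1 ≤ p)] {h : EuclideanSpace ℝ (Fin n) → G} {k : Lp G p ν}
    {η : EuclideanSpace ℝ (Fin n) → ℝ} (hk : k =ᵐ[ν] fun x => (η x : ℂ) • h x) {m : ℝ}
    (hm0 : 0 ≤ m) (hm : ∀ᵐ x ∂μ, 1 ≤ m * η x) {t : ℝ} (ht : 0 < t) :
    eLpNorm (fun x => t • h x) p μ ≤ ENNReal.ofReal (m * (t * ‖k‖)) := by
  change eLpNorm (t • h) p μ ≤ _
  rw [eLpNorm_const_smul, Real.enorm_of_nonneg ht.le, mul_left_comm, ENNReal.ofReal_mul ht.le]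
  gcongr
  exact eLpNorm_le_of_weight hμ hk hm0 hm

theorem eLpNorm_restrict_eq_of_support {E : Set (EuclideanSpace ℝ (Fin n))} (hED : E ⊆ D)
    (hE : NullMeasurableSet E volume) {f : L2 D}
    (hf : ∀ᵐ x ∂(volume.restrict D), x ∉ E → f x = 0) :
    eLpNorm f 2 (volume.restrict E) = ENNReal.ofReal ‖f‖ := by
  -- E is only null measurable, so a measurable set equal to it almost everywhere replaces it.
  obtain ⟨E', -, hE', hEE'⟩ := hE.exists_measurable_superset_ae_eq
  have hEE'' : E' =ᵐ[volume.restrict D] E := ae_restrict_of_ae hEE'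
  rw [Lp.norm_def, ENNReal.ofReal_toReal (Lp.memLp f).2.ne,
    ← Measure.restrict_restrict_of_subset hED, ← Measure.restrict_congr_set hEE'',
    ← eLpNorm_indicator_eq_eLpNorm_restrict hE']
  refine eLpNorm_congr_ae ?_
  filter_upwards [hf, hEE''.mem_iff] with x hx hiff
  by_cases hxE : x ∈ E'
  · rw [Set.indicator_of_mem hxE]
  · rw [Set.indicator_of_notMem hxE, hx (mt hiff.2 hxE)]

theorem off_diagonal_estimate (hD : MeasurableSet D) (hb : Bornology.IsBounded D)
    (hΓ : MeasurableSet Γ) (hΓD : Γ ⊆ closure D) {d : ℝ} {q : ℝ≥0∞} [Fact (1 ≤ q)]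
    {A : EuclideanSpace ℝ (Fin n) → Matrix (Fin n) (Fin n) ℂ} {b : EuclideanSpace ℝ (Fin n) → ℂ}
    {Λ : ℝ≥0} (hA : MemLp (coeff A) ∞ (volume.restrict D))
    (hΛ : eLpNorm (coeff A) ∞ (volume.restrict D) ≤ Λ) {lam : ℝ} (hlam : 0 < lam)
    (hco : ∀ u : W12 D, lam * ‖u‖ ^ 2 ≤ (robinForm D Γ d q A b u u).re)
    {c : ℝ} (hc : 0 ≤ c) (hc1 : c ≤ 1) (hcs : c * (2 * (Λ : ℝ) ^ 2 / lam + Λ) ≤ 1 / 2)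
    {t : ℝ} (ht : 0 < t) {E F : Set (EuclideanSpace ℝ (Fin n))} (hFD : F ⊆ D)
    (hF : NullMeasurableSet F volume) {f : L2 D}
    (hf : ∀ᵐ x ∂(volume.restrict D), x ∉ E → f x = 0) {u : W12 D}
    (hu : IsRobinResolvent D Γ d q A b t f u) :
    ∃ X Z m : ℝ, 0 ≤ X ∧ 0 ≤ Z ∧ X ≤ 2 * (Real.exp c * ‖f‖) ∧
      Z ≤ 2 / √lam * (Real.exp c * ‖f‖) ∧ m = Real.exp c * Real.exp (-c * setDist E F / t) ∧
      eLpNorm (sobFn u) 2 (volume.restrict F) ≤ ENNReal.ofReal (m * X) ∧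
      eLpNorm (fun x => t • sobFn u x) 2 (volume.restrict F) ≤ ENNReal.ofReal (m * Z) ∧
      eLpNorm (fun x => t • sobGrad u x) 2 (volume.restrict F) ≤ ENNReal.ofReal (m * (Z + X)) ∧
      eLpNorm (fun x => t • trace D Γ d q u x) q
        ((Measure.hausdorffMeasure d).restrict (closure F ∩ Γ)) ≤
          ENNReal.ofReal (m * (‖trace D Γ d q‖ * Z)) := by
  -- At smoothing scale t, the error in ψ changes the exponent (c / t) ψ by at most c.
  obtain ⟨ψ, hψ, hψ1, hψE⟩ := exists_smooth_lipschitz_approx (Metric.lipschitz_infDist_pt E) ht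
  have hst : c / t * t = c := div_mul_cancel₀ _ ht.ne'
  have hs : 0 ≤ c / t := div_nonneg hc ht.le
  have hfw : ∀ᵐ x ∂(volume.restrict D),
      ‖((Real.exp (c / t * ψ x) : ℝ) : ℂ) • f x‖ ≤ Real.exp c * ‖f x‖ := by
    filter_upwards [hf] with x hx
    by_cases hxE : x ∈ E
    · rw [norm_smul, Complex.norm_real, Real.norm_of_nonneg (Real.exp_nonneg _)]
      have h1 := (abs_le.1 (hψE x)).2
      rw [Metric.infDist_zero_of_mem hxE, sub_zero] at h1
      have h2 : c / t * ψ x ≤ c := (mul_le_mul_of_nonneg_left h1 hs).trans_eq hst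
      gcongr
    · rw [hx hxE, smul_zero, norm_zero, mul_zero]
  obtain ⟨w, P, hw, hgrad, htr, hP, henergy⟩ :=
    exists_weighted_energy hD hb hΓ hΓD hA hΛ hco hψ hψ1 hs ht hu hfw
  obtain ⟨hX, hZ⟩ := absorb_error hlam Λ.2 (norm_nonneg P) ht hst hc hc1 hcs
    (by positivity : 0 ≤ Real.exp c * ‖f‖) hP henergy
  set m : ℝ := Real.exp c * Real.exp (-c * setDist E F / t)
  have hm0 : 0 ≤ m := by positivity
  -- On the closure of F, ψ ≥ dist(E, F) - t, so m dominates the inverse of the weight.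
  have hm (x : EuclideanSpace ℝ (Fin n)) (hx : x ∈ closure F) :
      1 ≤ m * Real.exp (c / t * ψ x) := by
    simp only [m]
    rw [← Real.exp_add, ← Real.exp_add]
    refine Real.one_le_exp ?_
    have h1 : setDist E F - t ≤ ψ x := by
      linarith [setDist_le_infDist (E := E) hx, (abs_le.1 (hψE x)).1]
    have h2 := mul_le_mul_of_nonneg_left h1 hs
    rw [mul_sub, hst] at h2
    have h3 : -c * setDist E F / t = -(c / t * setDist E F) := by ring
    linarith
  have hmF : ∀ᵐ x ∂(volume.restrict F), 1 ≤ m * Real.exp (c / t * ψ x) :=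
    (ae_restrict_iff'₀ hF).2 (.of_forall fun x hx => hm x (subset_closure hx))
  have hmΓ : ∀ᵐ x ∂((Measure.hausdorffMeasure d).restrict (closure F ∩ Γ)),
      1 ≤ m * Real.exp (c / t * ψ x) :=
    (ae_restrict_iff' (isClosed_closure.measurableSet.inter hΓ)).2
      (.of_forall fun x hx => hm x hx.1)
  have hle : volume.restrict F ≤ volume.restrict D := Measure.restrict_mono hFD le_rfl
  have hleΓ : (Measure.hausdorffMeasure d).restrict (closure F ∩ Γ) ≤ surf d Γ :=
    Measure.restrict_mono Set.inter_subset_right le_rfl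
  refine ⟨‖sobFn w‖, t * ‖w‖, m, norm_nonneg _, by positivity, hX, hZ, rfl,
    eLpNorm_le_of_weight hle hw hm0 hmF,
    (eLpNorm_const_smul_le_of_weight hle hw hm0 hmF ht).trans ?_,
    (eLpNorm_const_smul_le_of_weight hle hgrad hm0 hmF ht).trans ?_,
    (eLpNorm_const_smul_le_of_weight hleΓ htr hm0 hmΓ ht).trans ?_⟩
  · gcongr
    exact norm_sobFn_le w
  -- The weighted gradient is ∇w - P, and t‖P‖ ≤ c‖w‖ ≤ ‖w‖ in L².
  · refine ENNReal.ofReal_le_ofReal (mul_le_mul_of_nonneg_left ?_ hm0)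
    calc t * ‖sobGrad w - P‖ ≤ t * (‖w‖ + c / t * ‖sobFn w‖) := by
          gcongr
          exact (norm_sub_le _ _).trans (add_le_add (norm_sobGrad_le w) hP)
      _ = t * ‖w‖ + c * ‖sobFn w‖ := by rw [mul_add, ← mul_assoc t (c / t), mul_comm t (c / t), hst]
      _ ≤ t * ‖w‖ + ‖sobFn w‖ := by
          gcongr
          exact mul_le_of_le_one_left (norm_nonneg _) hc1
  · rw [mul_left_comm ‖trace D Γ d q‖]
    gcongr
    exact (trace D Γ d q).le_opNorm w

end OffDiagonal

end

end Robin

/-! ### The constants and the proposition -/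

open Robin
theorem proposition3 (n : ℕ) (hn : 2 ≤ n) (lam : ℝ) (hlam : 0 < lam) (Λ : ℝ≥0) :
    ∃ C c : ℝ, 0 < C ∧ 0 < c ∧
      ∀ (D Γ : Set (EuclideanSpace ℝ (Fin n))),
      IsOpen D → Bornology.IsBounded D → IsLocallyUniform D →
      Γ.Nonempty → (∃ U : Set (EuclideanSpace ℝ (Fin n)), IsOpen U ∧ Γ = frontier D ∩ U) →
      ∀ d : ℝ, (n : ℝ) - 2 < d → d < n → IsDSet d Γ →
      -- the exponents: the integrability `q'` of the boundary conductivity, and the exponent `q`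
      ∀ q' : ℝ≥0∞, ENNReal.ofReal (d / (d + 2 - n)) < q' →
      ∀ (q : ℝ≥0∞) [Fact (1 ≤ q)], q'⁻¹ + 2 * q⁻¹ = 1 →
      -- the coefficients
      ∀ (A : EuclideanSpace ℝ (Fin n) → Matrix (Fin n) (Fin n) ℂ)
        (b : EuclideanSpace ℝ (Fin n) → ℂ),
      MemLp (coeff A) ∞ (volume.restrict D) → eLpNorm (coeff A) ∞ (volume.restrict D) ≤ Λ →
      MemLp b q' (surf d Γ) →
      (∀ u : W12 D, lam * ‖u‖ ^ 2 ≤ (robinForm D Γ d q A b u u).re) →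
      ∀ t : ℝ, 0 < t →
      -- the resolvent of the Robin operator is well defined
      (∀ f : L2 D, ∃! u : W12 D, IsRobinResolvent D Γ d q A b t f u) ∧
      -- the off-diagonal estimates
      ∀ E F : Set (EuclideanSpace ℝ (Fin n)), E ⊆ D → F ⊆ D →
        NullMeasurableSet E volume → NullMeasurableSet F volume →
      ∀ f : L2 D, (∀ᵐ x ∂(volume.restrict D), x ∉ E → f x = 0) →
      ∀ u : W12 D, IsRobinResolvent D Γ d q A b t f u →
        eLpNorm (sobFn u) 2 (volume.restrict F) +
            eLpNorm (fun x => t • sobFn u x) 2 (volume.restrict F) +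
            eLpNorm (fun x => t • sobGrad u x) 2 (volume.restrict F)
          ≤ ENNReal.ofReal (C * Real.exp (-c * setDist E F / t)) *
              eLpNorm f 2 (volume.restrict E) ∧
        eLpNorm (sobFn u) 2 (volume.restrict F) +
            eLpNorm (fun x => t • trace D Γ d q u x) q
              ((Measure.hausdorffMeasure d).restrict (closure F ∩ Γ)) +
            eLpNorm (fun x => t • sobFn u x) 2 (volume.restrict F) +
            eLpNorm (fun x => t • sobGrad u x) 2 (volume.restrict F)
          ≤ ENNReal.ofReal (C * (1 + ‖trace D Γ d q‖) * Real.exp (-c * setDist E F / t)) *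
              eLpNorm f 2 (volume.restrict E) := by
  have hB : 0 ≤ 2 * (Λ : ℝ) ^ 2 / lam + Λ := by positivity
  set B := 2 * (Λ : ℝ) ^ 2 / lam + Λ
  -- Chosen so that both c ≤ 1 and cB ≤ 1 / 2, the smallness used in `absorb_error`.
  set c : ℝ := 1 / (2 * B + 1) with hcdef
  have hc : 0 < c := by positivity
  have hc1 : c ≤ 1 := by
    rw [hcdef, div_le_one (by positivity)]
    linarith
  have hcs : c * B ≤ 1 / 2 := by
    rw [hcdef, div_mul_eq_mul_div, div_le_iff₀ (by positivity)]
    linarith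
  set S := 2 / √lam with hS
  have hS0 : 0 ≤ S := by positivity
  -- One factor exp(c) bounds the weight on E, the other comes from removing it on F. The rest is 2X
  -- + 2Z, with X ≤ 2κ and Z ≤ Sκ for κ = exp(c) ‖f‖.
  refine ⟨Real.exp c * (Real.exp c * (4 + 2 * S)), c, by positivity, hc, ?_⟩
  rintro D Γ hD hDb - - ⟨U, hU, rfl⟩ d - - - q' - q _ hq A b hA hΛ hb hco t ht
  have hΓ : MeasurableSet (frontier D ∩ U) := isClosed_frontier.measurableSet.inter hU.measurableSet
  have hΓD : frontier D ∩ U ⊆ closure D := Set.inter_subset_left.trans frontier_subset_closure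
  refine ⟨existsUnique_isRobinResolvent hq hA hΛ hb hlam hco ht, ?_⟩
  intro E F hED hFD hE hF f hf u hu
  obtain ⟨X, Z, m, hX0, hZ0, hX, hZ, hm, e1, e2, e3, e4⟩ :=
    off_diagonal_estimate hD.measurableSet hDb hΓ hΓD hA hΛ hlam hco hc.le hc1 hcs ht hFD hF hf hu
  rw [eLpNorm_restrict_eq_of_support hED hE hf]
  have hm0 : 0 ≤ m := hm ▸ by positivity
  have hg : 0 ≤ ‖trace D (frontier D ∩ U) d q‖ := ContinuousLinearMap.opNorm_nonneg _
  set g := ‖trace D (frontier D ∩ U) d q‖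
  set κ := Real.exp c * ‖f‖
  have hκ : 0 ≤ κ := by positivity
  have hSκ : 0 ≤ S * κ := mul_nonneg hS0 hκ
  constructor
  · refine (add_le_add (add_le_add e1 e2) e3).trans ?_
    rw [← ENNReal.ofReal_add (by positivity) (by positivity),
      ← ENNReal.ofReal_add (by positivity) (by positivity), ← ENNReal.ofReal_mul (by positivity)]
    refine ENNReal.ofReal_le_ofReal ?_
    calc m * X + m * Z + m * (Z + X) = m * (2 * X + 2 * Z) := by ring
      _ ≤ m * ((4 + 2 * S) * κ) := mul_le_mul_of_nonneg_left (by linarith) hm0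
      _ = _ := by rw [hm]; ring
  · refine (add_le_add (add_le_add (add_le_add e1 e4) e2) e3).trans ?_
    rw [← ENNReal.ofReal_add (by positivity) (by positivity),
      ← ENNReal.ofReal_add (by positivity) (by positivity),
      ← ENNReal.ofReal_add (by positivity) (by positivity), ← ENNReal.ofReal_mul (by positivity)]
    refine ENNReal.ofReal_le_ofReal ?_
    have hgZ : g * Z ≤ g * (S * κ) := mul_le_mul_of_nonneg_left hZ hg
    have hgκ : 0 ≤ g * κ := mul_nonneg hg hκ
    have hgS : 0 ≤ g * (S * κ) := mul_nonneg hg hSκ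
    calc m * X + m * (g * Z) + m * Z + m * (Z + X) = m * (2 * X + 2 * Z + g * Z) := by ring
      _ ≤ m * ((1 + g) * ((4 + 2 * S) * κ)) := mul_le_mul_of_nonneg_left (by linarith) hm0
      _ = _ := by rw [hm]; ring
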